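/- Let $X$ be a finite set with $|X|\ge 2$. An association scheme with $d$ classes on $X$ is a partition of $X\times X$ into nonempty relations $R_0,R_1,\dots,R_d$ such that (i) $R_0=\{(x,x): x\in X\}$; (ii) for each $i$ the inverse $R_i^{T}=\{(y,x):(x,y)\in R_i\}$ equals $R_{i'}$ for some index $i'$; (iii) for all $i,j,k$ the number $|\{z\in X:(x,z)\in R_i,\ (z,y)\in R_j\}|$ is the same for all $(x,y)\in R_k$. The scheme is skew-symmetric if $R_0$ is the only relation with $R_i^{T}=R_i$. A partition $\Lambda_0,\dots,\Lambda_e$ of $\{0,1,\dots,d\}$ into nonempty sets is admissible if $\Lambda_0=\{0\}$ and for every $1\le i\le e$ there is $1\le j\le e$ with $\{\alpha':\alpha\in\Lambda_i\}=\Lambda_j$. The scheme is amorphous if for every admissible partition the relations $\bigcup_{\alpha\in\Lambda_i}R_\alpha$ $(0\le i\le e)$ again form an association scheme on $X$. **Theorem.** There is no skew-symmetric amorphous association scheme with $4$ classes. -/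

import Mathlib

namespace AssociationScheme

variable {X : Type*} [Fintype X] {d e : ℕ}

/-- The binary relations `R 0, …, R d` on the finite set `X` form an association scheme with `d`
classes (not assumed to be commutative). -/
structure IsScheme (R : Fin (d + 1) → SetRel X X) : Prop where
  two_le_card : 2 ≤ Fintype.card X
  /-- `R` is a partition of `X × X`: the parts are nonempty, pairwise disjoint, and cover. -/
  nonempty : ∀ i, Set.Nonempty (R i)
  disjoint : ∀ i j, i ≠ j → Disjoint (R i) (R j)
  cover : ∀ x y : X, ∃ i, (x, y) ∈ R i
  /-- `R 0` is the diagonal relation. -/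
  diagonal : R 0 = {p : X × X | p.1 = p.2}
  /-- The inverse of every relation is among the relations. -/
  inverse : ∀ i, ∃ i', (R i).inv = R i'
  /-- The intersection numbers `p i j k` exist. -/
  intersection : ∀ i j k, ∃ p : ℕ, ∀ x y : X, (x, y) ∈ R k →
    {z : X | (x, z) ∈ R i ∧ (z, y) ∈ R j}.ncard = p

/-- The diagonal relation `R 0` is the only self-paired relation. -/
def IsSkewSymmetric (R : Fin (d + 1) → SetRel X X) : Prop :=
  ∀ i, (R i).inv = R i ↔ i = 0

/-- The inverse `{α' | α ∈ Λ}` of a set `Λ` of indices, where `α'` is the index with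
`(R α).inv = R α'` (unique in an association scheme, as the relations are distinct). -/
def indexInverse (R : Fin (d + 1) → SetRel X X) (Λ : Set (Fin (d + 1))) : Set (Fin (d + 1)) :=
  {β | ∃ α ∈ Λ, (R α).inv = R β}

/-- `Λ 0, …, Λ e` is an admissible partition of the index set `{0, …, d}`. -/
structure IsAdmissible (R : Fin (d + 1) → SetRel X X) (Λ : Fin (e + 1) → Set (Fin (d + 1))) :
    Prop where
  nonempty : ∀ i, (Λ i).Nonempty
  disjoint : ∀ i j, i ≠ j → Disjoint (Λ i) (Λ j)
  cover : ∀ α, ∃ i, α ∈ Λ i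
  zero : Λ 0 = {0}
  inverse : ∀ i, i ≠ 0 → ∃ j, j ≠ 0 ∧ indexInverse R (Λ i) = Λ j

/-- The relations `R_{Λ i} = ⋃_{α ∈ Λ i} R α` obtained by merging along `Λ`. -/
def fusion (R : Fin (d + 1) → SetRel X X) (Λ : Fin (e + 1) → Set (Fin (d + 1))) :
    Fin (e + 1) → SetRel X X :=
  fun i => ⋃ α ∈ Λ i, R α

/-- Every admissible partition of the index set gives rise to a fusion scheme. -/
def IsAmorphous (R : Fin (d + 1) → SetRel X X) : Prop :=
  ∀ (e : ℕ) (Λ : Fin (e + 1) → Set (Fin (d + 1))), IsAdmissible R Λ → IsScheme (fusion R Λ)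

end AssociationScheme

/-!
Let `R_p, R_p', R_q, R_q'` be the nontrivial relations, with adjacency matrices `A, Aᵀ, B, Bᵀ` and
valencies `k₁, k₁, k₂, k₂`, and put `a = A - Aᵀ`, `b = B - Bᵀ`, `C = A + Aᵀ`, `D = B + Bᵀ`,
`n = |X|`, with `J` the all-ones matrix. Only two fusions are needed: merging along
`{p, q}, {p', q'}` and along `{p, q'}, {p', q}` has to give schemes, that is, doubly regular
tournaments.

Double regularity means `(a + b)² = (a - b)² = J - n I`, and that the valency `k₁ + k₂` is odd
(`tournament_sq`). Hence `a² + b² = J - n I` and `a b = - b a`. So `a b` is skew, and being in the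
adjacency algebra it is a combination of `a` and `b`; anticommutation makes its traces against `a`
and `b` vanish, so `a b = 0`.

Writing `a²` as a combination of `I`, `C`, `D` and multiplying by `a` and by `b` gives `C a = r a`
and `C b = s b` with integers `r`, `s` (`exists_eigenvalues`). From `a b = b a = 0` one gets
`C b = 2 A b` and `D a = 2 B a`, so `s` and `1 + r` are even. Taking traces of `C (a² + b²)` and
`C² (a² + b²)` yields `2 k₁ = s (s - r + 1)` and `2 k₂ = -(1 + r) (s - r + 1)`, so both `k₁` and
`k₂` are even (`parity_contradiction`), contradicting that `k₁ + k₂` is odd.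

The scheme need not be known to be commutative: all products are kept in order.
-/

open Matrix

namespace AssociationScheme

/-! ### Matrix algebra -/

/-- The all-ones matrix. -/
def allOnes (X : Type*) : Matrix X X ℤ := Matrix.of fun _ _ => 1

theorem allOnes_apply {X : Type*} (x y : X) : allOnes X x y = 1 := rfl

theorem allOnes_transpose {X : Type*} : (allOnes X)ᵀ = allOnes X := rfl

theorem trace_allOnes {X : Type*} [Fintype X] : (allOnes X).trace = Fintype.card X := by
  simp [Matrix.trace, allOnes_apply]

theorem mul_allOnes_apply {X : Type*} [Fintype X] (M : Matrix X X ℤ) (x y : X) :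
    (M * allOnes X) x y = ∑ z, M x z := by
  simp [Matrix.mul_apply, allOnes_apply]

/-- Constant row sums of a matrix and of its transpose agree, by counting all entries twice. -/
theorem rowSum_eq_colSum {X : Type*} [Fintype X] [Nonempty X] {M : Matrix X X ℤ} {k k' : ℤ}
    (h : M * allOnes X = k • allOnes X) (h' : Mᵀ * allOnes X = k' • allOnes X) : k = k' := by
  have key := Finset.sum_comm (s := Finset.univ) (t := Finset.univ) (f := fun x y : X => M x y)
  have h1 : ∀ x, ∑ y, M x y = k := fun x => by
    rw [← mul_allOnes_apply M x x, h]; simp [allOnes_apply]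
  have h2 : ∀ x, ∑ y, M y x = k' := fun x => by
    have := mul_allOnes_apply Mᵀ x x
    rw [h'] at this
    simpa [allOnes_apply] using this.symm
  simp only [h1, h2, Finset.sum_const, Finset.card_univ, nsmul_eq_mul] at key
  exact mul_left_cancel₀ (by exact_mod_cast Fintype.card_ne_zero) key

/-- A matrix proportional to one with an entry `1` is an integral multiple of it. -/
theorem eq_smul_of_smul_eq_smul {X : Type*} {M a : Matrix X X ℤ} {c e : ℤ} (hc : c ≠ 0)
    (h : c • M = e • a) {x₀ y₀ : X} (h₀ : a x₀ y₀ = 1) : M = M x₀ y₀ • a := by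
  have hx : ∀ x y, c * M x y = e * a x y := fun x y => by simpa using congrFun₂ h x y
  ext x y
  apply mul_left_cancel₀ hc
  have := hx x₀ y₀
  rw [h₀, mul_one] at this
  simp only [Matrix.smul_apply, smul_eq_mul]
  rw [hx, ← this, mul_assoc]

/-- If the `{0, 1}`-matrix `T` is the adjacency matrix of a regular tournament of valency `k` in
which the two ends of any arc have the same number `l` of common out-neighbours, then
`k` is odd and the skew matrix `T - Tᵀ` squares to `J - n I`. -/
theorem tournament_sq {X : Type*} [Fintype X] [DecidableEq X] [Nonempty X] {T : Matrix X X ℤ}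
    {k l : ℤ} (h01 : ∀ x y, T x y = 0 ∨ T x y = 1) (hJ : 1 + T + Tᵀ = allOnes X)
    (hT : T * allOnes X = k • allOnes X) (hT' : Tᵀ * allOnes X = k • allOnes X) (hk : 0 < k)
    (hl : ∀ x y, T x y = 1 → (T * Tᵀ) x y = l) :
    Odd k ∧ (T - Tᵀ) * (T - Tᵀ) = allOnes X - (Fintype.card X : ℤ) • 1 := by
  have hJT : allOnes X * Tᵀ = k • allOnes X := by
    simpa only [Matrix.transpose_mul, Matrix.transpose_smul, allOnes_transpose] using
      congrArg Matrix.transpose hT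
  have hJJ : allOnes X * allOnes X = (Fintype.card X : ℤ) • allOnes X := by
    ext x y; simp [mul_allOnes_apply, allOnes_apply]
  have hsymm : ∀ x y, (T * Tᵀ) x y = (T * Tᵀ) y x := fun x y => by
    simp [Matrix.mul_apply, mul_comm]
  have hsum : ∀ x y, (1 : Matrix X X ℤ) x y + T x y + T y x = 1 := fun x y => by
    simpa [allOnes_apply] using congrFun₂ hJ x y
  have hTT : T * Tᵀ = k • 1 + l • (allOnes X - 1) := by
    ext x y
    by_cases hxy : x = y
    · subst hxy
      have h1 : (T * Tᵀ) x x = ∑ z, T x z := by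
        simp only [Matrix.mul_apply, Matrix.transpose_apply]
        refine Finset.sum_congr rfl fun z _ => ?_
        rcases h01 x z with h | h <;> simp [h]
      rw [h1, ← mul_allOnes_apply T x x, hT]
      simp only [Matrix.add_apply, Matrix.sub_apply, Matrix.smul_apply, allOnes_apply,
        Matrix.one_apply_eq, smul_eq_mul]
      ring
    · have h1 : (T * Tᵀ) x y = l := by
        have h2 := hsum x y
        rw [Matrix.one_apply_ne hxy] at h2
        rcases h01 x y with h | h
        · rw [hsymm]; exact hl y x (by linarith)
        · exact hl x y h
      rw [h1]
      simp only [Matrix.add_apply, Matrix.sub_apply, Matrix.smul_apply, allOnes_apply,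
        Matrix.one_apply_ne hxy, smul_eq_mul]
      ring
  obtain ⟨x⟩ := ‹Nonempty X›
  have hn : (Fintype.card X : ℤ) = 1 + 2 * k := by
    have h1 : (1 + T + Tᵀ) * allOnes X = (1 + k + k) • allOnes X := by
      rw [add_mul, add_mul, hT, hT', one_mul, add_smul, add_smul, one_smul]
    rw [hJ, hJJ] at h1
    have := congrFun₂ h1 x x
    simp only [Matrix.smul_apply, allOnes_apply, smul_eq_mul, mul_one] at this
    linarith
  have hkl : k = 1 + 2 * l := by
    have h1 := congrArg (· * allOnes X) hTT
    simp only [Matrix.mul_assoc, hT', hT, Matrix.mul_smul, add_mul, sub_mul, Matrix.smul_mul, hJJ,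
      one_mul] at h1
    have := congrFun₂ h1 x x
    simp only [Matrix.smul_apply, Matrix.add_apply, Matrix.sub_apply, allOnes_apply, smul_eq_mul,
      mul_one] at this
    rw [hn] at this
    apply mul_left_cancel₀ hk.ne'
    linarith
  refine ⟨⟨l, by linarith⟩, ?_⟩
  have e1 : Tᵀ = allOnes X - 1 - T := by rw [← hJ]; abel
  have e2 : T - Tᵀ = (2 : ℤ) • T + 1 - allOnes X := by rw [e1]; module
  have e3 : T - Tᵀ = allOnes X - 1 - (2 : ℤ) • Tᵀ := by rw [e1]; module
  have e4 : (T - Tᵀ) * (T - Tᵀ) = ((2 : ℤ) • T + 1 - allOnes X) *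
      (allOnes X - 1 - (2 : ℤ) • Tᵀ) := by rw [← e2, ← e3]
  rw [e4]
  simp only [mul_sub, sub_mul, add_mul, Matrix.smul_mul, Matrix.mul_smul, hT, hJT, hTT, hJJ,
    one_mul, mul_one]
  rw [e1, hn, hkl]
  module

/-- The arithmetic contradiction between the eigenvalues `r = 2 u - 1`, `s = 2 t` of a strongly
regular graph with valencies `2 k₁`, `2 k₂` and the parity of `k₁ + k₂`. -/
theorem parity_contradiction {k₁ k₂ r s t u : ℤ} (h₁ : 0 < k₁) (h₂ : 0 < k₂)
    (hodd : Odd (k₁ + k₂)) (hs : s = 2 * t) (hr : 1 + r = 2 * u)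
    (tr₁ : k₁ + r * k₁ + s * k₂ = 0)
    (tr₂ : 2 * k₁ ^ 2 - (1 + 2 * k₁ + 2 * k₂) * k₁ + r ^ 2 * k₁ + s ^ 2 * k₂ = 0) : False := by
  obtain rfl : r = 2 * u - 1 := by linarith
  subst hs
  have e₀ : k₁ * u = -(t * k₂) := by linarith
  have e₁ : k₁ = 2 * (t * (t - u + 1)) := by
    have : (2 * k₂) * k₁ = (2 * k₂) * (2 * (t * (t - u + 1))) := by
      linear_combination -tr₂ + 4 * (u - 1) * e₀
    exact mul_left_cancel₀ (by positivity) this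
  have ht : t ≠ 0 := by
    rintro rfl
    simp only [zero_mul, mul_zero] at e₁
    exact h₁.ne' e₁
  have e₂ : k₂ = 2 * (-u * (t - u + 1)) := by
    apply mul_left_cancel₀ ht
    linear_combination e₀ - u * e₁
  obtain ⟨m, hm⟩ := hodd
  omega

/-- If `a ^ 2 + b ^ 2 = J - n I` with `a b = b a = 0`, and `a ^ 2` is a combination of `I` and the
complementary graphs `C`, `D`, then the columns of `a`, and those of `b`, are eigenvectors of
`C` for a common integral eigenvalue, which is an entry of `C * a`, respectively of `C * b`. -/
theorem exists_eigenvalues {X : Type*} [Fintype X] [DecidableEq X] {a b C D : Matrix X X ℤ}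
    {n c l m : ℤ} (hn : n ≠ 0) (hCD : 1 + C + D = allOnes X) (hJa : allOnes X * a = 0)
    (hJb : allOnes X * b = 0) (hab : a * b = 0) (hba : b * a = 0)
    (hsq : a * a + b * b = allOnes X - n • 1) (ha : a * a = c • 1 + l • C + m • D)
    {x₀ y₀ x₁ y₁ : X} (h₀ : a x₀ y₀ = 1) (h₁ : b x₁ y₁ = 1) :
    C * a = (C * a) x₀ y₀ • a ∧ C * b = (C * b) x₁ y₁ • b := by
  have hD : D = allOnes X - 1 - C := by rw [← hCD]; abel
  -- Multiplying the formula for `a ^ 2` by `a`, where `a ^ 3 = -n a`, and by `b`, where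
  -- `a ^ 2 * b = 0`, determines `C * a` and `C * b` unless `l = m`.
  have e₁ : (l - m) • (C * a) = (m - c - n) • a := by
    have h1 : a * a * a = -n • a := by
      have : (a * a + b * b) * a = (allOnes X - n • 1) * a := by rw [hsq]
      rw [add_mul, Matrix.mul_assoc b, hba, mul_zero, add_zero, sub_mul, hJa, Matrix.smul_mul,
        one_mul, zero_sub, ← neg_smul] at this
      exact this
    rw [ha, hD] at h1
    simp only [add_mul, sub_mul, Matrix.smul_mul, one_mul, hJa] at h1
    linear_combination (norm := module) h1
  have e₂ : (l - m) • (C * b) = (m - c) • b := by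
    have h1 : a * a * b = 0 := by rw [Matrix.mul_assoc, hab, mul_zero]
    rw [ha, hD] at h1
    simp only [add_mul, sub_mul, Matrix.smul_mul, one_mul, hJb] at h1
    linear_combination (norm := module) h1
  have hlm : l - m ≠ 0 := by
    intro h
    rw [h, zero_smul] at e₁ e₂
    have f₁ := congrFun₂ e₁ x₀ y₀
    have f₂ := congrFun₂ e₂ x₁ y₁
    simp only [Matrix.smul_apply, Matrix.zero_apply, h₀, h₁, smul_eq_mul, mul_one] at f₁ f₂
    omega
  exact ⟨eq_smul_of_smul_eq_smul hlm e₁ h₀, eq_smul_of_smul_eq_smul hlm e₂ h₁⟩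

/-! ### The contradiction for adjacency matrices -/

/-- The linear-algebraic core: `A`, `B` and their transposes are the nontrivial adjacency matrices
of the scheme, and `A + B`, `A + Bᵀ` are those of its tournament fusions. -/
theorem false_of_adjacency {X : Type*} [Fintype X] [DecidableEq X] [Nonempty X]
    {A B : Matrix X X ℤ} {k₁ k₂ c l m : ℤ}
    (hJ : 1 + (A + Aᵀ) + (B + Bᵀ) = allOnes X)
    (hA : A * allOnes X = k₁ • allOnes X) (hA' : Aᵀ * allOnes X = k₁ • allOnes X)
    (hB : B * allOnes X = k₂ • allOnes X) (hB' : Bᵀ * allOnes X = k₂ • allOnes X)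
    (h₁ : 0 < k₁) (h₂ : 0 < k₂) (hodd : Odd (k₁ + k₂))
    (tA : A.trace = 0) (tAA : (A * A).trace = 0) (tAA' : (A * Aᵀ).trace = Fintype.card X * k₁)
    (tBB : (B * B).trace = 0) (tBB' : (B * Bᵀ).trace = Fintype.card X * k₂)
    (tAB : (A * B).trace = 0) (tAB' : (A * Bᵀ).trace = 0)
    {x₀ y₀ x₁ y₁ : X} (hx₀ : A x₀ y₀ = 1) (hy₀ : A y₀ x₀ = 0)
    (hx₁ : B x₁ y₁ = 1) (hy₁ : B y₁ x₁ = 0)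
    (hsq : (A - Aᵀ) * (A - Aᵀ) = c • 1 + l • (A + Aᵀ) + m • (B + Bᵀ))
    (hskew : ((A - Aᵀ) * (B - Bᵀ))ᵀ = -((A - Aᵀ) * (B - Bᵀ)) →
      ∃ α β : ℤ, (A - Aᵀ) * (B - Bᵀ) = α • (A - Aᵀ) + β • (B - Bᵀ))
    (hT : ((A + B) - (A + B)ᵀ) * ((A + B) - (A + B)ᵀ) =
      allOnes X - (Fintype.card X : ℤ) • 1)
    (hT' : ((A + Bᵀ) - (A + Bᵀ)ᵀ) * ((A + Bᵀ) - (A + Bᵀ)ᵀ) =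
      allOnes X - (Fintype.card X : ℤ) • 1) : False := by
  have hn0 : (Fintype.card X : ℤ) ≠ 0 := by exact_mod_cast Fintype.card_ne_zero
  generalize hn : (Fintype.card X : ℤ) = n at *
  have hJJ : allOnes X * allOnes X = n • allOnes X := by
    ext x y; simp [mul_allOnes_apply, allOnes_apply, ← hn]
  have hnk : n = 1 + 2 * k₁ + 2 * k₂ := by
    have h1 : (1 + (A + Aᵀ) + (B + Bᵀ)) * allOnes X = (1 + 2 * k₁ + 2 * k₂) • allOnes X := by
      simp only [add_mul, hA, hA', hB, hB', one_mul]; module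
    rw [hJ, hJJ] at h1
    simpa only [Matrix.smul_apply, allOnes_apply, smul_eq_mul, mul_one] using congrFun₂ h1 x₀ x₀
  obtain ⟨a, ha⟩ : ∃ a, a = A - Aᵀ := ⟨_, rfl⟩
  obtain ⟨b, hb⟩ : ∃ b, b = B - Bᵀ := ⟨_, rfl⟩
  have tr_a : ∀ M : Matrix X X ℤ, (Mᵀ).trace = M.trace := Matrix.trace_transpose
  have taa : (a * a).trace = -(2 * n * k₁) := by
    have e : (Aᵀ * Aᵀ).trace = 0 := by rw [← Matrix.transpose_mul, tr_a, tAA]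
    have e' : (Aᵀ * A).trace = n * k₁ := by rw [Matrix.trace_mul_comm, tAA']
    simp only [ha, mul_sub, sub_mul, Matrix.trace_sub, tAA, tAA', e, e']; ring
  have tbb : (b * b).trace = -(2 * n * k₂) := by
    have e : (Bᵀ * Bᵀ).trace = 0 := by rw [← Matrix.transpose_mul, tr_a, tBB]
    have e' : (Bᵀ * B).trace = n * k₂ := by rw [Matrix.trace_mul_comm, tBB']
    simp only [hb, mul_sub, sub_mul, Matrix.trace_sub, tBB, tBB', e, e']; ring
  have tab : (a * b).trace = 0 := by
    have e : (Aᵀ * Bᵀ).trace = 0 := by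
      rw [← Matrix.transpose_mul, tr_a, Matrix.trace_mul_comm, tAB]
    have e' : (Aᵀ * B).trace = 0 := by
      rw [← tr_a, Matrix.transpose_mul, Matrix.transpose_transpose, Matrix.trace_mul_comm, tAB']
    simp only [ha, hb, mul_sub, sub_mul, Matrix.trace_sub, tAB, tAB', e, e']; ring
  have tba : (b * a).trace = 0 := by rw [Matrix.trace_mul_comm, tab]
  have hT₁ : (a + b) * (a + b) = allOnes X - n • 1 := by
    rw [← hT, ha, hb, Matrix.transpose_add]; congr 1 <;> abel
  have hT₂ : (a - b) * (a - b) = allOnes X - n • 1 := by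
    rw [← hT', ha, hb, Matrix.transpose_add, Matrix.transpose_transpose]; congr 1 <;> abel
  simp only [add_mul, mul_add, sub_mul, mul_sub] at hT₁ hT₂
  have two_cancel : ∀ M N : Matrix X X ℤ, (2 : ℤ) • M = (2 : ℤ) • N → M = N :=
    fun M N h => smul_right_injective _ two_ne_zero h
  have hsum : a * a + b * b = allOnes X - n • 1 := by
    apply two_cancel
    linear_combination (norm := module) hT₁ + hT₂
  have hanti : b * a = -(a * b) := by
    apply two_cancel
    linear_combination (norm := module) hT₁ - hT₂
  have ha_t : aᵀ = -a := by rw [ha]; simp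
  have hb_t : bᵀ = -b := by rw [hb]; simp
  rw [← ha, ← hb] at hskew
  obtain ⟨α, β, hab'⟩ := hskew (by rw [Matrix.transpose_mul, ha_t, hb_t, neg_mul_neg, hanti])
  -- By anticommutation and cyclicity, `tr (a b a) = -tr (a b a)`; likewise for `a b b`.
  have hα : α = 0 := by
    have e₁ : (a * b * a).trace = α * (a * a).trace := by
      rw [hab', add_mul, Matrix.smul_mul, Matrix.smul_mul, Matrix.trace_add, Matrix.trace_smul,
        Matrix.trace_smul, tba, smul_zero, add_zero, smul_eq_mul]
    have e₂ : (a * b * a).trace = -(a * b * a).trace := by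
      conv_lhs => rw [Matrix.mul_assoc, hanti, mul_neg, Matrix.trace_neg, Matrix.trace_mul_comm]
    have e₃ : α * (a * a).trace = 0 := by linarith
    rw [taa] at e₃
    exact (mul_eq_zero.mp e₃).resolve_right (by simp [hn0, h₁.ne'])
  have hβ : β = 0 := by
    have e₁ : (a * b * b).trace = β * (b * b).trace := by
      rw [hab', add_mul, Matrix.smul_mul, Matrix.smul_mul, Matrix.trace_add, Matrix.trace_smul,
        Matrix.trace_smul, tab, smul_zero, zero_add, smul_eq_mul]
    have e₂ : (a * b * b).trace = -(a * b * b).trace := by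
      conv_lhs => rw [Matrix.trace_mul_comm, ← Matrix.mul_assoc, hanti, neg_mul, Matrix.trace_neg]
    have e₃ : β * (b * b).trace = 0 := by linarith
    rw [tbb] at e₃
    exact (mul_eq_zero.mp e₃).resolve_right (by simp [hn0, h₂.ne'])
  have hab : a * b = 0 := by rw [hab', hα, hβ, zero_smul, zero_smul, add_zero]
  have hba : b * a = 0 := by rw [hanti, hab, neg_zero]
  obtain ⟨C, hC⟩ : ∃ C, C = A + Aᵀ := ⟨_, rfl⟩
  obtain ⟨D, hD⟩ : ∃ D, D = B + Bᵀ := ⟨_, rfl⟩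
  rw [← ha, ← hC, ← hD] at hsq
  rw [← hC, ← hD] at hJ
  have haJ : a * allOnes X = 0 := by rw [ha, sub_mul, hA, hA', sub_self]
  have hbJ : b * allOnes X = 0 := by rw [hb, sub_mul, hB, hB', sub_self]
  have hJa : allOnes X * a = 0 := by
    have := congrArg Matrix.transpose haJ
    rw [Matrix.transpose_mul, ha_t, allOnes_transpose, mul_neg, Matrix.transpose_zero] at this
    exact neg_eq_zero.mp this
  have hJb : allOnes X * b = 0 := by
    have := congrArg Matrix.transpose hbJ
    rw [Matrix.transpose_mul, hb_t, allOnes_transpose, mul_neg, Matrix.transpose_zero] at this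
    exact neg_eq_zero.mp this
  have ha₀ : a x₀ y₀ = 1 := by simp [ha, hx₀, hy₀]
  have hb₁ : b x₁ y₁ = 1 := by simp [hb, hx₁, hy₁]
  obtain ⟨hr, hs⟩ := exists_eigenvalues hn0 hJ hJa hJb hab hba hsum hsq ha₀ hb₁
  -- The eigenvalue of `C` on `b` is even because `A * b = Aᵀ * b`.
  have hCb : C * b = (2 : ℤ) • (A * b) := by
    have : A * b - Aᵀ * b = 0 := by rw [← sub_mul, ← ha, hab]
    rw [hC, add_mul]
    linear_combination (norm := module) -this
  -- The eigenvalue of `D` on `a` is `-1 - r`, and it is even because `B * a = Bᵀ * a`.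
  have hCa : a + C * a = (2 : ℤ) • (-(B * a)) := by
    have e₁ : B * a - Bᵀ * a = 0 := by rw [← sub_mul, ← hb, hba]
    have e₂ : (1 + C + (B + Bᵀ)) * a = 0 := by rw [← hD, hJ, hJa]
    simp only [add_mul, one_mul] at e₂
    linear_combination (norm := module) e₂ + e₁
  have hs₂ : (C * b) x₁ y₁ = 2 * (A * b) x₁ y₁ := by rw [hCb]; simp
  have hr₂ : 1 + (C * a) x₀ y₀ = 2 * (-(B * a)) x₀ y₀ := by
    have := congrFun₂ hCa x₀ y₀
    rwa [Matrix.add_apply, ha₀, Matrix.smul_apply, smul_eq_mul] at this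
  generalize (C * a) x₀ y₀ = r at hr hr₂
  generalize (C * b) x₁ y₁ = s at hs hs₂
  have tC : C.trace = 0 := by rw [hC, Matrix.trace_add, tr_a, tA, add_zero]
  have hCJ : C * allOnes X = (2 * k₁) • allOnes X := by
    rw [hC, add_mul, hA, hA']; module
  have tCC : (C * C).trace = 2 * n * k₁ := by
    have e : (Aᵀ * Aᵀ).trace = 0 := by rw [← Matrix.transpose_mul, tr_a, tAA]
    have e' : (Aᵀ * A).trace = n * k₁ := by rw [Matrix.trace_mul_comm, tAA']
    simp only [hC, mul_add, add_mul, Matrix.trace_add, tAA, tAA', e, e']; ring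
  have tJ : (allOnes X).trace = n := by rw [trace_allOnes, hn]
  have tr₁ : n * (k₁ + r * k₁ + s * k₂) = 0 := by
    have e := congrArg (fun M => (C * M).trace) hsum
    simp only [mul_add, mul_sub, ← Matrix.mul_assoc, hr, hs, hCJ, Matrix.smul_mul,
      Matrix.mul_smul, mul_one, Matrix.trace_add, Matrix.trace_sub, Matrix.trace_smul, taa, tbb,
      tJ, tC, smul_eq_mul] at e
    linarith
  have tr₂ : n * (2 * k₁ ^ 2 - n * k₁ + r ^ 2 * k₁ + s ^ 2 * k₂) = 0 := by
    have e := congrArg (fun M => (C * (C * M)).trace) hsum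
    simp only [mul_add, mul_sub, ← Matrix.mul_assoc C a, ← Matrix.mul_assoc C b, hr, hs, hCJ,
      Matrix.smul_mul, Matrix.mul_smul, mul_one, Matrix.trace_add, Matrix.trace_sub,
      Matrix.trace_smul, taa, tbb, tJ, tCC, smul_eq_mul] at e
    linarith
  refine parity_contradiction h₁ h₂ hodd hs₂ hr₂ ((mul_eq_zero.mp tr₁).resolve_left hn0) ?_
  rw [← hnk]
  exact (mul_eq_zero.mp tr₂).resolve_left hn0

/-! ### Colourings of skew-symmetric schemes with four classes -/

/-- A skew-symmetric association scheme with four classes, encoded by the map `r` sending a pair to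
the index of its relation and by the involution `σ` of the indices induced by inversion. -/
structure SkewColoring {X : Type*} [Fintype X] (R : Fin (4 + 1) → SetRel X X)
    (r : X → X → Fin (4 + 1)) (σ : Fin (4 + 1) → Fin (4 + 1)) : Prop where
  mem : ∀ x y k, (x, y) ∈ R k ↔ r x y = k
  symm : ∀ x y, r y x = σ (r x y)
  surj : ∀ k, ∃ x y, r x y = k
  diag : ∀ x y, r x y = 0 ↔ x = y
  invol : ∀ k, σ (σ k) = k
  fixed : ∀ k, σ k = k ↔ k = 0
  inter : ∀ i j k, ∃ p : ℕ, ∀ x y, r x y = k →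
    (Finset.univ.filter fun z => r x z = i ∧ r z y = j).card = p

theorem exists_skewColoring {X : Type*} [Fintype X] {R : Fin (4 + 1) → SetRel X X}
    (hR : IsScheme R) (hs : IsSkewSymmetric R) : ∃ r σ, SkewColoring R r σ := by
  choose r hr using hR.cover
  choose σ hσ using hR.inverse
  have mem : ∀ x y k, (x, y) ∈ R k ↔ r x y = k := fun x y k => by
    refine ⟨fun h => ?_, fun h => h ▸ hr x y⟩
    by_contra hne
    exact Set.disjoint_left.mp (hR.disjoint _ _ hne) (hr x y) h
  have symm : ∀ x y, r y x = σ (r x y) := fun x y => by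
    rw [← mem, ← hσ]
    exact hr x y
  have surj : ∀ k, ∃ x y, r x y = k := fun k => by
    obtain ⟨⟨x, y⟩, h⟩ := hR.nonempty k
    exact ⟨x, y, (mem x y k).mp h⟩
  refine ⟨r, σ, mem, symm, surj, fun x y => ?_, fun k => ?_, fun k => ?_, fun i j k => ?_⟩
  · rw [← mem, hR.diagonal]; rfl
  · obtain ⟨x, y, rfl⟩ := surj k
    rw [← symm, ← symm]
  · rw [← hs k, hσ]
    refine ⟨fun h => by rw [h], fun h => ?_⟩
    obtain ⟨x, y, hxy⟩ := surj k
    have : (x, y) ∈ R (σ k) := by rw [h]; exact (mem x y k).mpr hxy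
    rw [← (mem x y _).mp this, hxy]
  · obtain ⟨p, hp⟩ := hR.intersection i j k
    refine ⟨p, fun x y h => ?_⟩
    rw [← hp x y ((mem x y k).mpr h), ← Set.ncard_coe_finset]
    congr 1
    ext z
    simp [mem]

/-- Representatives `p`, `q` of the two pairs of mutually inverse nontrivial relations. -/
theorem exists_index_pairs {σ : Fin (4 + 1) → Fin (4 + 1)}
    (fixed : ∀ k, σ k = k ↔ k = 0) : ∃ p q, p ≠ 0 ∧ q ≠ 0 ∧ q ≠ p ∧ q ≠ σ p := by
  have h1 : σ 1 ≠ 1 := fun h => by simpa using (fixed 1).mp h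
  by_cases h : σ 1 = 2
  · exact ⟨1, 3, by decide, by decide, by decide, by rw [h]; decide⟩
  · exact ⟨1, 2, by decide, by decide, by decide, fun h' => h h'.symm⟩

/-- The adjacency matrix of the relation with index `k`. -/
def adj {X : Type*} (r : X → X → Fin (4 + 1)) (k : Fin (4 + 1)) : Matrix X X ℤ :=
  Matrix.of fun x y => if r x y = k then 1 else 0

theorem adj_apply {X : Type*} (r : X → X → Fin (4 + 1)) (k : Fin (4 + 1)) (x y : X) :
    adj r k x y = if r x y = k then 1 else 0 := rfl

/-- The matrix `M` lies in the adjacency algebra: it is constant on every relation. -/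
def IsConstOn {X : Type*} (r : X → X → Fin (4 + 1)) (M : Matrix X X ℤ) : Prop :=
  ∃ f : Fin (4 + 1) → ℤ, ∀ x y, M x y = f (r x y)

theorem isConstOn_adj {X : Type*} (r : X → X → Fin (4 + 1)) (k : Fin (4 + 1)) :
    IsConstOn r (adj r k) :=
  ⟨fun i => if i = k then 1 else 0, fun _ _ => rfl⟩

theorem IsConstOn.sub {X : Type*} {r : X → X → Fin (4 + 1)} {M N : Matrix X X ℤ}
    (hM : IsConstOn r M) (hN : IsConstOn r N) : IsConstOn r (M - N) := by
  obtain ⟨f, hf⟩ := hM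
  obtain ⟨g, hg⟩ := hN
  exact ⟨f - g, fun x y => by simp [hf, hg]⟩

theorem trace_adj_mul_transpose {X : Type*} [Fintype X] {r : X → X → Fin (4 + 1)}
    {i : Fin (4 + 1)} {v : ℤ}
    (hv : adj r i * allOnes X = v • allOnes X) :
    (adj r i * (adj r i)ᵀ).trace = Fintype.card X * v := by
  have : ∀ x, (adj r i * (adj r i)ᵀ).diag x = v := fun x => by
    have e := mul_allOnes_apply (adj r i) x x
    rw [hv] at e
    simp only [Matrix.smul_apply, allOnes_apply, smul_eq_mul, mul_one] at e
    rw [e, Matrix.diag_apply, Matrix.mul_apply]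
    refine Finset.sum_congr rfl fun z _ => ?_
    rw [Matrix.transpose_apply, adj_apply]
    split_ifs <;> simp
  rw [Matrix.trace, Finset.sum_congr rfl fun x _ => this x]
  simp

namespace SkewColoring

variable {X : Type*} [Fintype X] {R : Fin (4 + 1) → SetRel X X} {r : X → X → Fin (4 + 1)}
  {σ : Fin (4 + 1) → Fin (4 + 1)}

/-- The matrices constant on the relations are closed under multiplication, by the existence of the
intersection numbers. -/
theorem isConstOn_mul (h : SkewColoring R r σ) {M N : Matrix X X ℤ} (hM : IsConstOn r M)
    (hN : IsConstOn r N) : IsConstOn r (M * N) := by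
  obtain ⟨f, hf⟩ := hM
  obtain ⟨g, hg⟩ := hN
  choose p hp using h.inter
  refine ⟨fun k => ∑ ij : Fin (4 + 1) × Fin (4 + 1), p ij.1 ij.2 k * (f ij.1 * g ij.2),
    fun x y => ?_⟩
  rw [Matrix.mul_apply, ← Finset.sum_fiberwise Finset.univ (fun z => (r x z, r z y))]
  refine Finset.sum_congr rfl fun ij _ => ?_
  rw [Finset.sum_congr rfl (g := fun _ => f ij.1 * g ij.2), Finset.sum_const, nsmul_eq_mul,
    ← hp ij.1 ij.2 (r x y) x y rfl]
  · simp only [Prod.ext_iff]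
  · intro z hz
    obtain rfl := (Finset.mem_filter.mp hz).2
    rw [hf, hg]

theorem transpose_adj (h : SkewColoring R r σ) (k : Fin (4 + 1)) :
    (adj r k)ᵀ = adj r (σ k) := by
  ext x y
  simp only [Matrix.transpose_apply, adj_apply]
  rw [h.symm x y]
  congr 1
  exact propext ⟨fun e => by rw [← e, h.invol], fun e => by rw [e, h.invol]⟩

theorem ne_of_index (h : SkewColoring R r σ) {p q : Fin (4 + 1)} (hp : p ≠ 0) (hq : q ≠ 0)
    (hqp : q ≠ p) (hqp' : q ≠ σ p) : σ p ≠ 0 ∧ σ q ≠ 0 ∧ σ p ≠ p ∧ σ q ≠ q ∧ σ q ≠ p ∧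
      σ q ≠ σ p := by
  have h0 : σ 0 = 0 := (h.fixed 0).mpr rfl
  refine ⟨fun e => hp ?_, fun e => hq ?_, fun e => hp ((h.fixed p).mp e),
    fun e => hq ((h.fixed q).mp e), fun e => hqp' ?_, fun e => hqp ?_⟩
  · rw [← h.invol p, e, h0]
  · rw [← h.invol q, e, h0]
  · rw [← e, h.invol]
  · rw [← h.invol q, e, h.invol]

theorem index_cases (h : SkewColoring R r σ) {p q : Fin (4 + 1)} (hp : p ≠ 0) (hq : q ≠ 0)
    (hqp : q ≠ p) (hqp' : q ≠ σ p) (k : Fin (4 + 1)) :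
    k = 0 ∨ k = p ∨ k = σ p ∨ k = q ∨ k = σ q := by
  obtain ⟨h1, h2, h3, h4, h5, h6⟩ := h.ne_of_index hp hq hqp hqp'
  omega

/-- A skew matrix in the adjacency algebra is a combination of the two skew differences. -/
theorem eq_of_skew (h : SkewColoring R r σ) {p q : Fin (4 + 1)} (hp : p ≠ 0) (hq : q ≠ 0)
    (hqp : q ≠ p) (hqp' : q ≠ σ p) {M : Matrix X X ℤ} (hM : IsConstOn r M) (hs : Mᵀ = -M) :
    ∃ α β : ℤ, M = α • (adj r p - (adj r p)ᵀ) + β • (adj r q - (adj r q)ᵀ) := by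
  obtain ⟨h1, h2, h3, h4, h5, h6⟩ := h.ne_of_index hp hq hqp hqp'
  obtain ⟨f, hf⟩ := hM
  have hfσ : ∀ k, f (σ k) = -f k := fun k => by
    obtain ⟨x, y, rfl⟩ := h.surj k
    rw [← h.symm, ← hf, ← hf]
    exact congrFun₂ hs x y
  have hf0 : f 0 = 0 := by
    have := hfσ 0
    rw [(h.fixed 0).mpr rfl] at this
    linarith
  refine ⟨f p, f q, ?_⟩
  rw [h.transpose_adj, h.transpose_adj]
  ext x y
  simp only [Matrix.add_apply, Matrix.sub_apply, Matrix.smul_apply, adj_apply, hf]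
  rcases h.index_cases hp hq hqp hqp' (r x y) with e | e | e | e | e <;> rw [e] <;>
    simp [*, hp.symm, hq.symm, hqp.symm, hqp'.symm, h1.symm, h2.symm, h3.symm, h4.symm, h5.symm,
      h6.symm]

/-- Every relation is regular, and its valency is positive. -/
theorem exists_valency (h : SkewColoring R r σ) (k : Fin (4 + 1)) :
    ∃ v : ℤ, 0 < v ∧ adj r k * allOnes X = v • allOnes X := by
  obtain ⟨p, hp⟩ := h.inter k (σ k) 0
  have hrow : ∀ x, ∑ z, adj r k x z = p := fun x => by
    simp only [adj_apply]
    rw [← hp x x ((h.diag x x).mpr rfl), Finset.sum_boole]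
    congr 2
    ext z
    simp only [Finset.mem_filter, Finset.mem_univ, true_and]
    exact ⟨fun e => ⟨e, by rw [h.symm x z, e]⟩, fun e => e.1⟩
  refine ⟨p, ?_, ?_⟩
  · obtain ⟨x, y, hxy⟩ := h.surj k
    rw [← hrow x]
    refine Finset.sum_pos' (fun z _ => ?_) ⟨y, Finset.mem_univ y, ?_⟩
    · rw [adj_apply]; split_ifs <;> simp
    · simp [adj_apply, hxy]
  · ext x y
    rw [mul_allOnes_apply, hrow]
    simp [allOnes_apply]

/-- Disjoint relations have orthogonal adjacency matrices for the trace form. -/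
theorem trace_adj_mul_adj (h : SkewColoring R r σ) {i j : Fin (4 + 1)} (hij : j ≠ σ i) :
    (adj r i * adj r j).trace = 0 := by
  refine Finset.sum_eq_zero fun x _ => ?_
  rw [Matrix.diag_apply, Matrix.mul_apply]
  refine Finset.sum_eq_zero fun z _ => ?_
  simp only [adj_apply]
  by_cases e : r x z = i
  · rw [h.symm x z, e, if_neg hij.symm, mul_zero]
  · rw [if_neg e, zero_mul]

/-! ### Tournament fusions and the adjacency algebra -/

/-- The partition `{0}, {p, q}, {p', q'}` is admissible, so amorphicity makes the union of the
relations `p` and `q` a tournament with constant intersection numbers. -/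
theorem exists_fusion_number (h : SkewColoring R r σ) (ham : IsAmorphous R) {p q : Fin (4 + 1)}
    (hp : p ≠ 0) (hq : q ≠ 0) (hqp : q ≠ p) (hqp' : q ≠ σ p) :
    ∃ l : ℤ, ∀ x y, (adj r p + adj r q) x y = 1 →
      ((adj r p + adj r q) * (adj r p + adj r q)ᵀ) x y = l := by
  obtain ⟨h1, h2, h3, h4, h5, h6⟩ := h.ne_of_index hp hq hqp hqp'
  have hinv : ∀ i j, (R i).inv = R j ↔ σ i = j := fun i j => by
    constructor
    · intro e
      obtain ⟨x, y, rfl⟩ := h.surj i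
      have : (y, x) ∈ (R (r x y)).inv := (h.mem x y _).mpr rfl
      rw [e, h.mem, h.symm x y] at this
      exact this
    · rintro rfl
      ext ⟨x, y⟩
      rw [SetRel.mem_inv, h.mem, h.mem, h.symm y x]
      exact ⟨fun e => by rw [e], fun e => by rw [← h.invol (r y x), e, h.invol]⟩
  have hadm : IsAdmissible R (![{0}, {p, q}, {σ p, σ q}] : Fin (2 + 1) → _) := by
    refine ⟨fun i => ?_, fun i j hij => ?_, fun k => ?_, rfl, fun i hi => ?_⟩
    · fin_cases i <;> simp
    · fin_cases i <;> fin_cases j <;>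
        simp [*, hp.symm, hq.symm, hqp'.symm, h1.symm, h2.symm, h3.symm, h4.symm,
          h5.symm] at hij ⊢
    · rcases h.index_cases hp hq hqp hqp' k with e | e | e | e | e
      · exact ⟨0, by simp [e]⟩
      · exact ⟨1, by simp [e]⟩
      · exact ⟨2, by simp [e]⟩
      · exact ⟨1, by simp [e]⟩
      · exact ⟨2, by simp [e]⟩
    · fin_cases i
      · exact absurd rfl hi
      · refine ⟨2, by decide, ?_⟩
        ext k
        simp [indexInverse, hinv, eq_comm]
      · refine ⟨1, by decide, ?_⟩
        ext k
        simp [indexInverse, hinv, eq_comm, h.invol]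
  obtain ⟨l, hl⟩ := (ham _ _ hadm).intersection 1 2 1
  have hmem1 : ∀ x y, (x, y) ∈ fusion R (![{0}, {p, q}, {σ p, σ q}] : Fin (2 + 1) → _) 1 ↔
      r x y = p ∨ r x y = q := fun x y => by simp [fusion, h.mem]
  have hmem2 : ∀ x y, (x, y) ∈ fusion R (![{0}, {p, q}, {σ p, σ q}] : Fin (2 + 1) → _) 2 ↔
      r x y = σ p ∨ r x y = σ q := fun x y => by simp [fusion, h.mem]
  have hadj : ∀ i j x y, i ≠ j → (adj r i + adj r j) x y =
      if r x y = i ∨ r x y = j then 1 else 0 := fun i j x y hij => by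
    simp only [Matrix.add_apply, adj_apply]
    by_cases e : r x y = i
    · simp [e, hij]
    · simp [e]
  refine ⟨l, fun x y hxy => ?_⟩
  have hxy' : (x, y) ∈ fusion R (![{0}, {p, q}, {σ p, σ q}] : Fin (2 + 1) → _) 1 := by
    rw [hmem1]
    by_contra e
    rw [hadj _ _ _ _ hqp.symm, if_neg e] at hxy
    exact zero_ne_one hxy
  have key := hl x y hxy'
  simp only [hmem1, hmem2] at key
  rw [← key, Matrix.transpose_add, h.transpose_adj, h.transpose_adj, Matrix.mul_apply]
  simp only [hadj _ _ _ _ hqp.symm, hadj _ _ _ _ h6.symm, ← ite_and, mul_ite, mul_one, mul_zero]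
  rw [Finset.sum_boole, ← Set.ncard_coe_finset]
  congr 2
  ext z
  simp [and_comm]

variable [DecidableEq X]

theorem sum_adj (h : SkewColoring R r σ) {p q : Fin (4 + 1)} (hp : p ≠ 0) (hq : q ≠ 0)
    (hqp : q ≠ p) (hqp' : q ≠ σ p) :
    1 + (adj r p + (adj r p)ᵀ) + (adj r q + (adj r q)ᵀ) = allOnes X := by
  obtain ⟨h1, h2, h3, h4, h5, h6⟩ := h.ne_of_index hp hq hqp hqp'
  rw [h.transpose_adj, h.transpose_adj]
  ext x y
  simp only [Matrix.add_apply, adj_apply, allOnes_apply, Matrix.one_apply, ← h.diag]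
  rcases h.index_cases hp hq hqp hqp' (r x y) with e | e | e | e | e <;> rw [e] <;>
    simp [*, hp.symm, hq.symm, hqp.symm, hqp'.symm, h1.symm, h2.symm, h3.symm, h4.symm, h5.symm,
      h6.symm]

/-- A symmetric matrix in the adjacency algebra is a combination of the symmetrized relations. -/
theorem eq_of_symm (h : SkewColoring R r σ) {p q : Fin (4 + 1)} (hp : p ≠ 0) (hq : q ≠ 0)
    (hqp : q ≠ p) (hqp' : q ≠ σ p) {M : Matrix X X ℤ} (hM : IsConstOn r M) (hs : Mᵀ = M) :
    ∃ c l m : ℤ, M = c • 1 + l • (adj r p + (adj r p)ᵀ) + m • (adj r q + (adj r q)ᵀ) := by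
  obtain ⟨h1, h2, h3, h4, h5, h6⟩ := h.ne_of_index hp hq hqp hqp'
  obtain ⟨f, hf⟩ := hM
  have hfσ : ∀ k, f (σ k) = f k := fun k => by
    obtain ⟨x, y, rfl⟩ := h.surj k
    rw [← h.symm, ← hf, ← hf]
    exact congrFun₂ hs x y
  refine ⟨f 0, f p, f q, ?_⟩
  rw [h.transpose_adj, h.transpose_adj]
  ext x y
  simp only [Matrix.add_apply, Matrix.smul_apply, adj_apply, Matrix.one_apply, ← h.diag, hf]
  rcases h.index_cases hp hq hqp hqp' (r x y) with e | e | e | e | e <;> rw [e] <;>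
    simp [*, hp.symm, hq.symm, hqp.symm, hqp'.symm, h1.symm, h2.symm, h3.symm, h4.symm, h5.symm,
      h6.symm]

/-- The tournament obtained by merging the relations `p` and `q`. -/
theorem tournament_fusion [Nonempty X] (h : SkewColoring R r σ) (ham : IsAmorphous R)
    {p q : Fin (4 + 1)} (hp : p ≠ 0) (hq : q ≠ 0) (hqp : q ≠ p) (hqp' : q ≠ σ p) {k₁ k₂ : ℤ}
    (h₁ : 0 < k₁) (h₂ : 0 < k₂)
    (hA : adj r p * allOnes X = k₁ • allOnes X) (hA' : (adj r p)ᵀ * allOnes X = k₁ • allOnes X)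
    (hB : adj r q * allOnes X = k₂ • allOnes X)
    (hB' : (adj r q)ᵀ * allOnes X = k₂ • allOnes X) :
    Odd (k₁ + k₂) ∧ ((adj r p + adj r q) - (adj r p + adj r q)ᵀ) *
      ((adj r p + adj r q) - (adj r p + adj r q)ᵀ) =
        allOnes X - (Fintype.card X : ℤ) • 1 := by
  obtain ⟨l, hl⟩ := h.exists_fusion_number ham hp hq hqp hqp'
  refine tournament_sq (fun x y => ?_) ?_ ?_ ?_ (by positivity) hl
  · simp only [Matrix.add_apply, adj_apply]
    by_cases e : r x y = p
    · simp [e, hqp.symm]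
    · simpa [e] using (ne_or_eq (r x y) q)
  · rw [← h.sum_adj hp hq hqp hqp', Matrix.transpose_add]; abel
  · rw [add_mul, hA, hB, add_smul]
  · rw [Matrix.transpose_add, add_mul, hA', hB', add_smul]

end SkewColoring

/-- A skew-symmetric scheme with four classes has a tournament fusion that is not a scheme:
otherwise its adjacency matrices would satisfy the hypotheses of `false_of_adjacency`. -/
theorem not_isAmorphous {X : Type*} [Fintype X] {R : Fin (4 + 1) → SetRel X X}
    (hR : IsScheme R) (hs : IsSkewSymmetric R) : ¬ IsAmorphous R := by
  classical
  intro ham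
  obtain ⟨r, σ, h⟩ := exists_skewColoring hR hs
  obtain ⟨p, q, hp, hq, hqp, hqp'⟩ := exists_index_pairs h.fixed
  obtain ⟨h1, h2, h3, h4, h5, h6⟩ := h.ne_of_index hp hq hqp hqp'
  obtain ⟨x₀, y₀, hxy₀⟩ := h.surj p
  obtain ⟨x₁, y₁, hxy₁⟩ := h.surj q
  have : Nonempty X := ⟨x₀⟩
  have hval : ∀ k, ∃ v : ℤ, 0 < v ∧ adj r k * allOnes X = v • allOnes X ∧
      (adj r k)ᵀ * allOnes X = v • allOnes X := fun k => by
    obtain ⟨v, hv, e⟩ := h.exists_valency k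
    obtain ⟨v', -, e'⟩ := h.exists_valency (σ k)
    rw [← h.transpose_adj] at e'
    refine ⟨v, hv, e, ?_⟩
    rw [rowSum_eq_colSum e e', e']
  obtain ⟨k₁, hk₁, hA, hA'⟩ := hval p
  obtain ⟨k₂, hk₂, hB, hB'⟩ := hval q
  have hconst : ∀ k, IsConstOn r (adj r k - (adj r k)ᵀ) := fun k => by
    rw [h.transpose_adj]
    exact (isConstOn_adj r k).sub (isConstOn_adj r (σ k))
  obtain ⟨c, l, m, hsq⟩ := h.eq_of_symm hp hq hqp hqp' (h.isConstOn_mul (hconst p) (hconst p)) (by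
    rw [Matrix.transpose_mul, Matrix.transpose_sub, Matrix.transpose_transpose, ← neg_sub,
      neg_mul_neg])
  obtain ⟨hodd, hT⟩ := h.tournament_fusion ham hp hq hqp hqp' hk₁ hk₂ hA hA' hB hB'
  have hT' := (h.tournament_fusion ham hp h2 h5 h6 hk₁ hk₂ hA hA'
    (by rwa [← h.transpose_adj]) (by rwa [← h.transpose_adj, Matrix.transpose_transpose])).2
  rw [← h.transpose_adj q] at hT'
  refine false_of_adjacency (h.sum_adj hp hq hqp hqp') hA hA' hB hB' hk₁ hk₂ hodd ?_
    (h.trace_adj_mul_adj h3.symm) (trace_adj_mul_transpose hA) (h.trace_adj_mul_adj h4.symm)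
    (trace_adj_mul_transpose hB) (h.trace_adj_mul_adj hqp')
    (by rw [h.transpose_adj]; exact h.trace_adj_mul_adj h6) (x₀ := x₀) (y₀ := y₀) (x₁ := x₁)
    (y₁ := y₁) ?_ ?_ ?_ ?_ hsq
    (h.eq_of_skew hp hq hqp hqp' (h.isConstOn_mul (hconst p) (hconst q))) hT hT'
  · refine Finset.sum_eq_zero fun x _ => ?_
    rw [Matrix.diag_apply, adj_apply, (h.diag x x).mpr rfl, if_neg hp.symm]
  · rw [adj_apply, if_pos hxy₀]
  · rw [adj_apply, h.symm x₀ y₀, hxy₀, if_neg h3]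
  · rw [adj_apply, if_pos hxy₁]
  · rw [adj_apply, h.symm x₁ y₁, hxy₁, if_neg h4]

end AssociationScheme

/-- There is no skew-symmetric amorphous association scheme with 4 classes. -/
theorem theorem1p1 {X : Type*} [Fintype X] (R : Fin (4 + 1) → SetRel X X) :
    ¬ (AssociationScheme.IsScheme R ∧ AssociationScheme.IsSkewSymmetric R ∧
      AssociationScheme.IsAmorphous R) :=
  fun ⟨hR, hs, ham⟩ => AssociationScheme.not_isAmorphous hR hs ham
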